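/- Consider the $k$-means, $k$-median or $k$-center problem with outliers on a metric space $(X,d)$ with $|X|=n$. For a set $C\subseteq X$ of $k$ centers and a set $O\subseteq X$ of outliers, let $\mathrm{cost}(X\setminus O,C)$ be $\sum_{x\in X\setminus O} d(x,C)^2$, $\sum_{x\in X\setminus O} d(x,C)$ or $\max_{x\in X\setminus O} d(x,C)$, respectively, where $d(x,C)=\min_{c\in C}d(x,c)$. Let $\mathrm{OPT}$ be the minimum of $\mathrm{cost}(X\setminus O,C)$ over all $C,O\subseteq X$ with $|C|=k$ and $|O|=z$. A set $C$ of $k$ centers is an $(\alpha,\beta)$-approximation if there is a set $O\subseteq X$ with $|O|\le\beta z$ and $\mathrm{cost}(X\setminus O,C)\le\alpha\,\mathrm{OPT}$. In the distance-oracle model, an algorithm knows $k,z,n$, learns about $d$ only by adaptively querying the distances of pairs of points, and outputs only a set of $k$ centers (it need not identify the outliers). A randomized algorithm is a random choice of a deterministic one, and its query complexity $T(k,z,n)$ is an upper bound on the number of its queries over all $n$-point metric spaces and all outcomes of its randomness. **Theorem.** Fix one of the three problems, and let $\mathcal A$ be a randomized algorithm for it in this model, whose query complexity satisfies $T(k,z,n)=o(nk^2/z)$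 as $k,z,n\to\infty$ subject to $10000\,k\log k\le z\le n/10000$. Then there are instances $X_{k,z,n}$ ($n$-point metric spaces) such that for all constants $\alpha,\beta\ge 0$ the following holds: for all sufficiently large $k,z,n$ (how large may depend on $\alpha$ and $\beta$) with $10000\,k\log k\le z\le n/10000$ and $20\,\beta z\le n$, the probability that $\mathcal A$ outputs an $(\alpha,\beta)$-approximation on $X_{k,z,n}$ is less than $0.5$. -/

import Mathlib

open Filter Asymptotics MeasureTheory
open scoped ENNReal NNReal

universe u

/-! ### Clustering with outliers in a finite metric space

An input instance with `n` points is a metric space structure on the point set `Fin n`. -/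

/-- The three clustering objectives. -/
inductive Objective where
  | kMeans
  | kMedian
  | kCenter

/-- The distance from the point `i` to the set of centers `C` (it is `∞` if `C` is empty). -/
noncomputable def distTo {n : ℕ} (M : MetricSpace (Fin n)) (C : Finset (Fin n)) (i : Fin n) :
    ℝ≥0∞ :=
  ⨅ c ∈ C, ENNReal.ofReal (M.dist i c)

/-- The cost of the set of points `S` with respect to the set of centers `C`: the sum of the squared
distances to `C`, the sum of the distances to `C`, or the largest distance to `C`. -/
noncomputable def clusterCost {n : ℕ} (obj : Objective) (M : MetricSpace (Fin n))
    (S C : Finset (Fin n)) : ℝ≥0∞ :=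
  match obj with
  | .kMeans => ∑ i ∈ S, distTo M C i ^ 2
  | .kMedian => ∑ i ∈ S, distTo M C i
  | .kCenter => ⨆ i ∈ S, distTo M C i

/-- The optimal cost over all choices of `k` centers and `z` outliers. -/
noncomputable def optCost {n : ℕ} (obj : Objective) (M : MetricSpace (Fin n)) (k z : ℕ) : ℝ≥0∞ :=
  ⨅ (C : Finset (Fin n)) (_ : C.card = k) (O : Finset (Fin n)) (_ : O.card = z),
    clusterCost obj M Oᶜ C

/-- `C` is an `(α, β)`-approximate solution: it consists of `k` centers, and after discarding some
set of at most `β * z` outliers its cost is at most `α` times the optimal cost with `z` outliers.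
(The outliers need not be found by the algorithm that outputs `C`.) -/
def IsApproxSolution {n : ℕ} (obj : Objective) (M : MetricSpace (Fin n)) (k z : ℕ) (α β : ℝ≥0)
    (C : Finset (Fin n)) : Prop :=
  C.card = k ∧ ∃ O : Finset (Fin n), (O.card : ℝ≥0) ≤ β * z ∧
    clusterCost obj M Oᶜ C ≤ α * optCost obj M k z

/-! ### The distance-oracle model -/

/-- A deterministic adaptive algorithm on `n` points: it either stops and outputs a set of centers,
or queries the distance between two points and continues depending on the answer. -/
inductive QueryAlgorithm (n : ℕ) where
  | output (C : Finset (Fin n)) : QueryAlgorithm n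
  | query (i j : Fin n) (next : ℝ → QueryAlgorithm n) : QueryAlgorithm n

/-- The set of centers that the algorithm outputs on the instance `M`. -/
def QueryAlgorithm.run {n : ℕ} (M : MetricSpace (Fin n)) : QueryAlgorithm n → Finset (Fin n)
  | .output C => C
  | .query i j next => (next (M.dist i j)).run M

/-- The number of oracle queries that the algorithm makes on the instance `M`. -/
def QueryAlgorithm.numQueries {n : ℕ} (M : MetricSpace (Fin n)) : QueryAlgorithm n → ℕ
  | .output _ => 0
  | .query i j next => (next (M.dist i j)).numQueries M + 1

/-- A randomized algorithm: a deterministic algorithm for each value `ω` of the random bits, which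
are drawn from an arbitrary probability space, so that the output on each instance is a random
variable. -/
structure RandomizedAlgorithm (n : ℕ) where
  Ω : Type u
  [measurableSpace : MeasurableSpace Ω]
  μ : Measure Ω
  [isProbabilityMeasure : IsProbabilityMeasure μ]
  alg : Ω → QueryAlgorithm n
  measurableSet_run : ∀ (M : MetricSpace (Fin n)) (C : Finset (Fin n)),
    MeasurableSet {ω | (alg ω).run M = C}

attribute [instance] RandomizedAlgorithm.measurableSpace RandomizedAlgorithm.isProbabilityMeasure

/-- The algorithm makes at most `t` queries on every instance, whatever its random bits are. -/
def RandomizedAlgorithm.MakesAtMost {n : ℕ} (A : RandomizedAlgorithm.{u} n) (t : ℕ) : Prop :=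
  ∀ (M : MetricSpace (Fin n)) (ω : A.Ω), (A.alg ω).numQueries M ≤ t

/-- The probability that the output on the instance `M` is an `(α, β)`-approximate solution. -/
noncomputable def RandomizedAlgorithm.successProb {n : ℕ} (A : RandomizedAlgorithm.{u} n)
    (obj : Objective) (M : MetricSpace (Fin n)) (k z : ℕ) (α β : ℝ≥0) : ℝ≥0∞ :=
  A.μ {ω | IsApproxSolution obj M k z α β ((A.alg ω).run M)}

/-- The parameters `(k, z, n)` tend to infinity subject to `10000 k log k ≤ z ≤ n / 10000`. -/
noncomputable def parameterFilter : Filter (ℕ × ℕ × ℕ) :=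
  (atTop ×ˢ atTop ×ˢ atTop) ⊓
    𝓟 {p | 10000 * (p.1 : ℝ) * Real.log p.1 ≤ p.2.1 ∧ (p.2.1 : ℝ) ≤ p.2.2 / 10000}

/-! The proof is Yao's principle applied to a random clustering. Let `D = k / 40` and label the
points independently by `30 * D` small clusters of total probability `p` and `10 * D` large ones;
distances are `1` inside a cluster and `L = n ^ 2` across. One center per cluster costs at most `n`,
so for `α < n` an approximate solution must leave at most `β * z` points in clusters without a
center (`IsApproxSolution.card_uncovered_le`). The mass `p`, roughly `H * z / n` up to constants and
at most `1 / 8`, is such that missing half of the small clusters leaves too many points, provided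
their sizes are close to the mean on average (`lt_card_uncovered`). Hence about `15 * D` centers
must lie in small clusters.

Finding such centers is expensive. As long as the queries at a point `c` answer `L`, each one
excludes a single label, and `D` labels carry mass at most `1 / 10`; so `c` lies in a small cluster
with probability barely above `p` unless it takes part in about `D` queries
(`QueryAlgorithm.exists_blocked_labels`). Charging queries to points, the expected number of centers
in small clusters is at most `p / 0.9 * (k + 2 * T / D)` (`labelExpectation_card_inter_le`). Here `p
* k` is at most `41 / 8 * D`, and `p * T / D` is a small multiple of `D` because `T` is small
against `n * k ^ 2 / z`. Markov's inequality keeps the success probability below `1 / 2`.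

This gives an instance for each bound `H` on `α` and `β`; a diagonal choice of `H` makes it
independent of them. -/

/-! ### Instances made of well separated clusters -/

open scoped Classical in
/-- The metric in which distinct points are at distance `1` or `L`, according to whether they have
the same label. -/
@[reducible]
noncomputable def clusterMetric {n : ℕ} {Λ : Type*} (L : ℝ) (hL : 1 ≤ L) (f : Fin n → Λ) :
    MetricSpace (Fin n) where
  dist i j := if i = j then 0 else if f i = f j then 1 else L
  dist_self i := by simp
  dist_comm i j := by simp only [eq_comm]
  dist_triangle i j l := by
    by_cases h1 : i = j <;> by_cases h2 : j = l <;> by_cases h3 : i = l <;>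
      by_cases h4 : f i = f j <;> by_cases h5 : f j = f l <;> by_cases h6 : f i = f l <;>
      simp_all <;> linarith
  eq_of_dist_eq_zero := by
    intro i j h
    by_contra hij
    have : (if i = j then (0 : ℝ) else if f i = f j then 1 else L) = 0 := h
    rw [if_neg hij] at this
    split_ifs at this <;> linarith

open scoped Classical in
/-- The points whose label differs from the labels of all centers in `C`. -/
noncomputable def uncovered {n : ℕ} {Λ : Type*} (f : Fin n → Λ) (C : Finset (Fin n)) :
    Finset (Fin n) :=
  Finset.univ.filter fun i => ∀ c ∈ C, f i ≠ f c

theorem mem_uncovered {n : ℕ} {Λ : Type*} {f : Fin n → Λ} {C : Finset (Fin n)} {i : Fin n} :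
    i ∈ uncovered f C ↔ ∀ c ∈ C, f i ≠ f c := by
  simp [uncovered]

section ClusterMetric

variable {n : ℕ} {Λ : Type*} {L : ℝ} {hL : 1 ≤ L} {f : Fin n → Λ}

open scoped Classical in
theorem clusterMetric_dist (i j : Fin n) :
    (clusterMetric L hL f).dist i j = if i = j then 0 else if f i = f j then 1 else L := rfl

theorem clusterMetric_dist_le_one {i j : Fin n} (h : f i = f j) :
    (clusterMetric L hL f).dist i j ≤ 1 := by
  rw [clusterMetric_dist]
  split_ifs <;> norm_num

theorem clusterMetric_dist_of_label_ne {i j : Fin n} (h : f i ≠ f j) :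
    (clusterMetric L hL f).dist i j = L := by
  rw [clusterMetric_dist, if_neg (fun e => h (congrArg f e)), if_neg h]

theorem clusterMetric_dist_congr {g : Fin n → Λ} {i j : Fin n}
    (h : i = j ∨ (f i = g i ∧ f j = g j)) :
    (clusterMetric L hL f).dist i j = (clusterMetric L hL g).dist i j := by
  rw [clusterMetric_dist, clusterMetric_dist]
  rcases h with h | ⟨h1, h2⟩
  · simp [h]
  · rw [h1, h2]

theorem distTo_clusterMetric_le_one {C : Finset (Fin n)} {i : Fin n} (h : ∃ c ∈ C, f i = f c) :
    distTo (clusterMetric L hL f) C i ≤ 1 := by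
  obtain ⟨c, hc, h⟩ := h
  refine (iInf₂_le c hc).trans ?_
  rw [ENNReal.ofReal_le_one]
  exact clusterMetric_dist_le_one h

theorem le_distTo_clusterMetric {C : Finset (Fin n)} {i : Fin n} (h : ∀ c ∈ C, f i ≠ f c) :
    ENNReal.ofReal L ≤ distTo (clusterMetric L hL f) C i :=
  le_iInf₂ fun c hc => by rw [clusterMetric_dist_of_label_ne (h c hc)]

theorem clusterCost_le_of_distTo_le_one (obj : Objective) {M : MetricSpace (Fin n)}
    {S C : Finset (Fin n)} (hn : 0 < n) (h : ∀ i ∈ S, distTo M C i ≤ 1) :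
    clusterCost obj M S C ≤ n := by
  have hS : (S.card : ℝ≥0∞) ≤ n := by
    exact_mod_cast (S.card_le_univ).trans_eq (Fintype.card_fin n)
  cases obj with
  | kMeans =>
    refine (Finset.sum_le_card_nsmul S _ 1 fun i hi => pow_le_one' (h i hi) 2).trans ?_
    simpa using hS
  | kMedian =>
    refine (Finset.sum_le_card_nsmul S _ 1 h).trans ?_
    simpa using hS
  | kCenter =>
    refine (iSup₂_le h).trans ?_
    exact_mod_cast hn

/-- The condition `1 ≤ a` serves $k$-means, where squaring must not decrease the distance. -/
theorem le_clusterCost_of_le_distTo (obj : Objective) {M : MetricSpace (Fin n)}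
    {S C : Finset (Fin n)} {i : Fin n} (hi : i ∈ S) {a : ℝ≥0∞} (ha : 1 ≤ a)
    (h : a ≤ distTo M C i) : a ≤ clusterCost obj M S C := by
  cases obj with
  | kMeans =>
    refine (h.trans ?_).trans
      (Finset.single_le_sum (f := fun i => distTo M C i ^ 2) (fun _ _ => zero_le) hi)
    exact le_self_pow₀ (ha.trans h) two_ne_zero
  | kMedian => exact h.trans (Finset.single_le_sum (f := distTo M C) (fun _ _ => zero_le) hi)
  | kCenter => exact h.trans (le_iSup₂ (f := fun i _ => distTo M C i) i hi)

/-- One representative of each nonempty cluster is within distance `1` of all its points. The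
remaining centers and all outliers are arbitrary and only fill up the prescribed cardinalities. -/
theorem optCost_clusterMetric_le [Fintype Λ] (obj : Objective) {k z : ℕ} (hn : 0 < n)
    (hΛ : Fintype.card Λ ≤ k) (hk : k ≤ n) (hz : z ≤ n) :
    optCost obj (clusterMetric L hL f) k z ≤ n := by
  classical
  obtain ⟨R, hR, hRf⟩ : ∃ R : Finset (Fin n), R.card ≤ k ∧ ∀ i, ∃ c ∈ R, f i = f c := by
    choose g hg using fun l : Set.range f => l.2
    refine ⟨Finset.univ.image g, ?_, fun i => ⟨g ⟨f i, i, rfl⟩, by simp, (hg ⟨f i, i, rfl⟩).symm⟩⟩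
    refine (Finset.card_image_le.trans ?_).trans hΛ
    exact Fintype.card_le_of_injective _ Subtype.val_injective
  obtain ⟨C, hRC, -, hC⟩ := Finset.exists_subsuperset_card_eq (Finset.subset_univ R) hR
    (by simpa using hk)
  obtain ⟨O, -, hO⟩ := Finset.exists_subset_card_eq (s := (Finset.univ : Finset (Fin n)))
    (n := z) (by simpa using hz)
  refine (iInf₂_le C hC).trans ((iInf₂_le O hO).trans ?_)
  refine clusterCost_le_of_distTo_le_one obj hn fun i _ => distTo_clusterMetric_le_one ?_
  obtain ⟨c, hc, h⟩ := hRf i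
  exact ⟨c, hRC hc, h⟩

/-- A solution of the cluster instance of bounded cost leaves few points in clusters without a
center. -/
theorem IsApproxSolution.card_uncovered_le [Fintype Λ] {obj : Objective} {k z : ℕ} {α β : ℝ≥0}
    {C : Finset (Fin n)} (h : IsApproxSolution obj (clusterMetric L hL f) k z α β C)
    (hΛ : Fintype.card Λ ≤ k) (hk : k ≤ n) (hz : z ≤ n) (hn : 0 < n)
    (hα : (α : ℝ) * n < L) :
    ((uncovered f C).card : ℝ) ≤ β * z := by
  obtain ⟨-, O, hO, hcost⟩ := h
  -- A single uncovered point that is not discarded already costs `L > α * n`.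
  have hsub : (uncovered f C) ⊆ O := by
    intro i hi
    by_contra hiO
    have h1 := le_clusterCost_of_le_distTo obj (M := clusterMetric L hL f) (S := Oᶜ) (C := C)
      (Finset.mem_compl.2 hiO) (a := ENNReal.ofReal L) (ENNReal.one_le_ofReal.2 hL)
      (le_distTo_clusterMetric (mem_uncovered.1 hi))
    have h2 : ENNReal.ofReal L ≤ α * n :=
      (h1.trans hcost).trans (by gcongr; exact optCost_clusterMetric_le obj hn hΛ hk hz)
    have h3 : (α : ℝ≥0∞) * n = ENNReal.ofReal (α * n) := by
      rw [ENNReal.ofReal_mul (NNReal.coe_nonneg α), ENNReal.ofReal_coe_nnreal, ENNReal.ofReal_natCast]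
    rw [h3, ENNReal.ofReal_le_ofReal_iff (by positivity)] at h2
    linarith
  calc ((uncovered f C).card : ℝ)
      ≤ O.card := by exact_mod_cast Finset.card_le_card hsub
    _ ≤ β * z := by exact_mod_cast hO

end ClusterMetric

/-! ### The queries that involve a given point -/

/-- The number of queries that involve the point `c`. -/
def QueryAlgorithm.queryDegree {n : ℕ} (M : MetricSpace (Fin n)) (c : Fin n) :
    QueryAlgorithm n → ℕ
  | .output _ => 0
  | .query i j next => (next (M.dist i j)).queryDegree M c +
      ((if c = i then 1 else 0) + if c = j then 1 else 0)

theorem QueryAlgorithm.sum_queryDegree {n : ℕ} (M : MetricSpace (Fin n)) (a : QueryAlgorithm n) :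
    ∑ c, a.queryDegree M c = 2 * a.numQueries M := by
  induction a with
  | output C => simp [queryDegree, numQueries]
  | query i j next ih =>
    simp only [queryDegree, numQueries, Finset.sum_add_distrib, ih]
    simp
    ring

/-- If only the label of `c` varies, then outside a small set of labels either the output does not
depend on the label, or `c` takes part in many queries. -/
theorem QueryAlgorithm.exists_blocked_labels {n : ℕ} {Λ : Type*} {L : ℝ} (hL : 1 ≤ L)
    (f : Fin n → Λ) (c : Fin n) (a : QueryAlgorithm n) (D : ℕ) :
    ∃ B : Finset Λ, B.card ≤ D ∧
      ((∃ C, ∀ l ∉ B, a.run (clusterMetric L hL (Function.update f c l)) = C ∧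
          B.card ≤ a.queryDegree (clusterMetric L hL (Function.update f c l)) c) ∨
        ∀ l ∉ B, D ≤ a.queryDegree (clusterMetric L hL (Function.update f c l)) c) := by
  classical
  induction a generalizing D with
  | output C => exact ⟨∅, by simp, Or.inl ⟨C, fun l _ => by simp [run]⟩⟩
  | query i j next ih =>
    -- Only a query of `c` against another point `b` depends on the label of `c`, and its answer is
    -- `L` unless that label is `f b`. Blocking `f b` forces the branch `next L`.
    by_cases hc : i ≠ j ∧ (c = i ∨ c = j)
    · obtain ⟨b, hbc, hb⟩ : ∃ b, b ≠ c ∧ ∀ l, l ≠ f b →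
          (clusterMetric L hL (Function.update f c l)).dist i j = L := by
        obtain ⟨hij, rfl | rfl⟩ := hc
        · refine ⟨j, hij.symm, fun l hl => clusterMetric_dist_of_label_ne ?_⟩
          simpa [Function.update_of_ne hij.symm] using hl
        · refine ⟨i, hij, fun l hl => clusterMetric_dist_of_label_ne ?_⟩
          simpa [Function.update_of_ne hij] using hl.symm
      have hdeg : 1 ≤ (if c = i then 1 else 0) + if c = j then 1 else 0 := by
        rcases hc.2 with h | h <;> simp [h]
      cases D with
      -- The budget of `D` queries at `c` is exhausted, so the second alternative holds.
      | zero => exact ⟨∅, by simp, Or.inr fun l _ => Nat.zero_le _⟩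
      | succ D =>
        obtain ⟨B, hB, h⟩ := ih L D
        have hins := Finset.card_insert_le (f b) B
        refine ⟨insert (f b) B, by omega, ?_⟩
        rcases h with ⟨C, h⟩ | h
        · refine Or.inl ⟨C, fun l hl => ?_⟩
          rw [Finset.mem_insert, not_or] at hl
          have hl' := h l hl.2
          simp only [run, queryDegree, hb l hl.1]
          exact ⟨hl'.1, by omega⟩
        · refine Or.inr fun l hl => ?_
          rw [Finset.mem_insert, not_or] at hl
          have hl' := h l hl.2
          simp only [queryDegree, hb l hl.1]
          omega
    · have hd : ∀ l, (clusterMetric L hL (Function.update f c l)).dist i j =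
          (clusterMetric L hL f).dist i j := by
        intro l
        apply clusterMetric_dist_congr
        by_cases hij : i = j
        · exact Or.inl hij
        · have : c ≠ i ∧ c ≠ j := by tauto
          exact Or.inr ⟨Function.update_of_ne this.1.symm _ _,
            Function.update_of_ne this.2.symm _ _⟩
      obtain ⟨B, hB, h⟩ := ih ((clusterMetric L hL f).dist i j) D
      refine ⟨B, hB, ?_⟩
      rcases h with ⟨C, h⟩ | h
      · refine Or.inl ⟨C, fun l hl => ?_⟩
        have hl' := h l hl
        simp only [run, queryDegree, hd]
        exact ⟨hl'.1, by omega⟩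
      · refine Or.inr fun l hl => ?_
        have hl' := h l hl
        simp only [queryDegree, hd]
        omega

/-! ### Cluster sizes -/

section LabelCount

variable {n : ℕ} {Λ : Type*}

open scoped Classical in
/-- The number of points with label `l`. -/
noncomputable def labelCount (f : Fin n → Λ) (l : Λ) : ℝ :=
  ∑ i, if f i = l then 1 else 0

open scoped Classical in
/-- A set of centers that meets less than half of the clusters in `S`, all of expected size `μ`,
leaves many points uncovered unless the cluster sizes deviate from `μ`. -/
theorem lt_card_uncovered (f : Fin n → Λ) (C : Finset (Fin n)) (S : Finset Λ) {μ : ℝ} (hμ : 0 < μ)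
    (hN : ∑ c, (if f c ∈ S ∧ c ∈ C then (1 : ℝ) else 0) < S.card / 2)
    (hV : ∑ l ∈ S, (labelCount f l - μ) ^ 2 < S.card * μ ^ 2 / 250) :
    0.44 * (S.card * μ) < (uncovered f C).card := by
  classical
  set U := S \ C.image f with hU
  have hUcard : (S.card : ℝ) / 2 < U.card := by
    have h1 : S ∩ C.image f ⊆ (Finset.univ.filter fun c => f c ∈ S ∧ c ∈ C).image f := by
      intro l hl
      obtain ⟨c, hc, rfl⟩ := Finset.mem_image.1 (Finset.mem_inter.1 hl).2
      exact Finset.mem_image.2 ⟨c, by simp [hc, (Finset.mem_inter.1 hl).1], rfl⟩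
    have h2 : ((S ∩ C.image f).card : ℝ) ≤ ∑ c, (if f c ∈ S ∧ c ∈ C then (1 : ℝ) else 0) := by
      rw [Finset.sum_boole]
      exact_mod_cast (Finset.card_le_card h1).trans Finset.card_image_le
    have h3 : (U.card : ℝ) + (S ∩ C.image f).card = S.card := by
      exact_mod_cast Finset.card_sdiff_add_card_inter S (C.image f)
    linarith
  have hcount : ∑ l ∈ U, labelCount f l ≤
      (uncovered f C).card := by
    simp only [labelCount]
    rw [Finset.sum_comm, uncovered, Finset.card_filter]
    push_cast
    refine Finset.sum_le_sum fun i _ => ?_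
    rw [Finset.sum_ite_eq]
    split_ifs with h1 h2
    · exact le_rfl
    · push Not at h2
      obtain ⟨c, hc, h2⟩ := h2
      refine absurd (Finset.mem_image.2 ⟨c, hc, h2.symm⟩) (Finset.mem_sdiff.1 h1).2
    · exact zero_le_one
    · exact le_rfl
  -- A lower bound linear in the squared deviation, by completing the square. Summed, it is uniform
  -- in the set `U`, which depends on `f`, so no union bound is needed. The final constant is `0.9 /
  -- 2 - 0.01 = 0.44`.
  have hpoint : ∀ l, 0.9 * μ - 2.5 / μ * (labelCount f l - μ) ^ 2 ≤ labelCount f l := by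
    intro l
    have : labelCount f l - (0.9 * μ - 2.5 / μ * (labelCount f l - μ) ^ 2) =
        2.5 / μ * (labelCount f l - μ + μ / 5) ^ 2 := by
      field_simp
      ring
    have h2 : 0 ≤ 2.5 / μ * (labelCount f l - μ + μ / 5) ^ 2 := by positivity
    linarith
  have hsum : 0.9 * μ * U.card - 2.5 / μ * ∑ l ∈ S, (labelCount f l - μ) ^ 2 ≤
      ∑ l ∈ U, labelCount f l := by
    have h1 := Finset.sum_le_sum fun l (_ : l ∈ U) => hpoint l
    simp only [Finset.sum_sub_distrib, Finset.sum_const, nsmul_eq_mul, ← Finset.mul_sum] at h1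
    have h2 : ∑ l ∈ U, (labelCount f l - μ) ^ 2 ≤ ∑ l ∈ S, (labelCount f l - μ) ^ 2 :=
      Finset.sum_le_sum_of_subset_of_nonneg Finset.sdiff_subset fun _ _ _ => sq_nonneg _
    have h3 := mul_le_mul_of_nonneg_left h2 (show 0 ≤ 2.5 / μ by positivity)
    linarith
  have h4 : 2.5 / μ * ∑ l ∈ S, (labelCount f l - μ) ^ 2 < 0.01 * (S.card * μ) := by
    calc _ < 2.5 / μ * (S.card * μ ^ 2 / 250) := by gcongr
      _ = 0.01 * (S.card * μ) := by field_simp; ring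
  have h5 := mul_lt_mul_of_pos_left hUcard (show 0 < 0.9 * μ by positivity)
  linarith

end LabelCount

/-! ### Independent random labels -/

section RandomLabels

variable {n : ℕ} {Λ : Type*} [Fintype Λ] {w : Λ → ℝ}

/-- The expectation of `F` when the labels of the points are independent with distribution `w`. -/
noncomputable def labelExpectation (w : Λ → ℝ) (F : (Fin n → Λ) → ℝ) : ℝ :=
  ∑ f : Fin n → Λ, (∏ i, w (f i)) * F f

theorem labelExpectation_mono (hw : ∀ l, 0 ≤ w l) {F G : (Fin n → Λ) → ℝ} (h : ∀ f, F f ≤ G f) :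
    labelExpectation w F ≤ labelExpectation w G :=
  Finset.sum_le_sum fun f _ =>
    mul_le_mul_of_nonneg_left (h f) (Finset.prod_nonneg fun _ _ => hw _)

theorem labelExpectation_const (hw : ∑ l, w l = 1) (a : ℝ) :
    labelExpectation w (fun _ : Fin n → Λ => a) = a := by
  classical
  have h := Finset.prod_univ_sum (fun _ : Fin n => (Finset.univ : Finset Λ)) (fun _ l => w l)
  simp only [hw, Finset.prod_const_one, Fintype.piFinset_univ] at h
  rw [labelExpectation, ← Finset.sum_mul, ← h, one_mul]

theorem labelExpectation_add (F G : (Fin n → Λ) → ℝ) :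
    labelExpectation w (fun f => F f + G f) = labelExpectation w F + labelExpectation w G := by
  simp [labelExpectation, mul_add, Finset.sum_add_distrib]

theorem labelExpectation_const_mul (a : ℝ) (F : (Fin n → Λ) → ℝ) :
    labelExpectation w (fun f => a * F f) = a * labelExpectation w F := by
  simp only [labelExpectation, Finset.mul_sum]
  exact Finset.sum_congr rfl fun f _ => by ring

theorem labelExpectation_sum {ι : Type*} (s : Finset ι) (F : ι → (Fin n → Λ) → ℝ) :
    labelExpectation w (fun f => ∑ i ∈ s, F i f) = ∑ i ∈ s, labelExpectation w (F i) := by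
  simp only [labelExpectation, Finset.mul_sum]
  exact Finset.sum_comm

/-- Resampling the label of one point does not change expectations. -/
theorem labelExpectation_resample (hw : ∑ l, w l = 1) (c : Fin n) (F : (Fin n → Λ) → ℝ) :
    labelExpectation w (fun f => ∑ l, w l * F (Function.update f c l)) = labelExpectation w F := by
  classical
  have hprod : ∀ (f : Fin n → Λ) (l : Λ),
      (∏ i, w (Function.update f c l i)) * w (f c) = (∏ i, w (f i)) * w l := by
    intro f l
    rw [Fintype.prod_eq_mul_prod_compl c, Fintype.prod_eq_mul_prod_compl c (fun i => w (f i))]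
    have : ∏ i ∈ {c}ᶜ, w (Function.update f c l i) = ∏ i ∈ {c}ᶜ, w (f i) :=
      Finset.prod_congr rfl fun i hi => by
        rw [Function.update_of_ne (by simpa using hi)]
    rw [this, Function.update_self]
    ring
  have hswap : ∑ x : (Fin n → Λ) × Λ,
      (∏ i, w (x.1 i)) * w x.2 * F (Function.update x.1 c x.2) =
      ∑ x : (Fin n → Λ) × Λ, (∏ i, w (x.1 i)) * w x.2 * F x.1 := by
    -- Exchanging the label of `c` with the fresh label is an involution that preserves the weight.
    refine Fintype.sum_bijective (fun x => (Function.update x.1 c x.2, x.1 c))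
      (Function.Involutive.bijective fun x => by simp) _ _ fun x => ?_
    simp only [hprod]
  rw [Fintype.sum_prod_type, Fintype.sum_prod_type] at hswap
  calc labelExpectation w (fun f => ∑ l, w l * F (Function.update f c l))
      = ∑ f : Fin n → Λ, ∑ l, (∏ i, w (f i)) * w l * F (Function.update f c l) := by
        simp only [labelExpectation, Finset.mul_sum, mul_assoc]
    _ = ∑ f : Fin n → Λ, ∑ l, (∏ i, w (f i)) * w l * F f := hswap
    _ = labelExpectation w F := by
        refine Finset.sum_congr rfl fun f _ => ?_
        rw [← Finset.sum_mul, ← Finset.mul_sum, hw, mul_one]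

/-- This is the binomial variance bound: resampling point `i` shows that the centered indicators of
distinct points are uncorrelated. -/
theorem labelExpectation_sq_labelCount_sub_le (hw0 : ∀ l, 0 ≤ w l) (hw : ∑ l, w l = 1) (l : Λ) :
    labelExpectation w (fun f : Fin n → Λ => (labelCount f l - n * w l) ^ 2) ≤ n * w l := by
  classical
  set X : Fin n → (Fin n → Λ) → ℝ := fun i f => (if f i = l then 1 else 0) - w l with hX
  have hsum : ∀ f : Fin n → Λ, (labelCount f l - n * w l) ^ 2 = ∑ i, ∑ j, X i f * X j f := by
    intro f
    rw [← Finset.sum_mul_sum, ← sq]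
    simp [hX, labelCount]
  have hmean : ∑ m, w m * ((if m = l then (1 : ℝ) else 0) - w l) = 0 := by
    simp [mul_sub, ← Finset.sum_mul, hw]
  have hdiag : ∀ i, labelExpectation w (fun f => X i f * X i f) ≤ w l := by
    intro i
    rw [← labelExpectation_resample hw i]
    refine (labelExpectation_mono hw0 fun f => ?_).trans_eq (labelExpectation_const hw (w l))
    have h1 : ∀ m, w m * (X i (Function.update f i m) * X i (Function.update f i m)) =
        w m * ((if m = l then (1 : ℝ) else 0) - w l) * (-w l)
          + (if m = l then w m * (1 - w l) else 0) := by
      intro m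
      simp only [hX, Function.update_self]
      split_ifs <;> ring
    simp only [h1, Finset.sum_add_distrib, ← Finset.sum_mul, hmean]
    simp
    nlinarith [hw0 l]
  have hoff : ∀ i j, i ≠ j → labelExpectation w (fun f => X i f * X j f) = 0 := by
    intro i j hij
    rw [← labelExpectation_resample hw i, ← labelExpectation_const (n := n) hw 0]
    congr 1
    funext f
    have h1 : ∀ m, w m * (X i (Function.update f i m) * X j (Function.update f i m)) =
        w m * ((if m = l then (1 : ℝ) else 0) - w l) * X j f := by
      intro m
      simp only [hX, Function.update_self, Function.update_of_ne hij.symm]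
      ring
    simp only [h1, ← Finset.sum_mul, hmean, zero_mul]
  simp only [hsum, labelExpectation_sum]
  calc ∑ i, ∑ j, labelExpectation w (fun f => X i f * X j f)
      ≤ ∑ i : Fin n, w l := by
        refine Finset.sum_le_sum fun i _ => ?_
        rw [Finset.sum_eq_single i (fun j _ hj => hoff i j hj.symm) (by simp)]
        exact hdiag i
    _ = n * w l := by simp

open scoped Classical in
/-- Few centers that the algorithm outputs (after some postprocessing `g`) lie in the clusters in
`S`: it finds such centers hardly better than by guessing, unless it makes many queries. -/
theorem labelExpectation_card_inter_le {L : ℝ} (hL : 1 ≤ L) (hw0 : ∀ l, 0 ≤ w l)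
    (hw : ∑ l, w l = 1) (S : Finset Λ) {σ θ : ℝ} (hS : ∀ l ∈ S, w l = σ) (hσ : 0 ≤ σ) {D : ℕ}
    (hD : 0 < D) (hDS : D ≤ S.card) (hθ : ∀ l, D * w l ≤ θ) (hθ1 : θ < 1)
    (a : QueryAlgorithm n) (g : Finset (Fin n) → Finset (Fin n)) :
    labelExpectation w (fun f => ∑ c,
        if f c ∈ S ∧ c ∈ g (a.run (clusterMetric L hL f)) then (1 : ℝ) else 0) ≤
      S.card * σ / (1 - θ) * labelExpectation w (fun f =>
        (g (a.run (clusterMetric L hL f))).card + 2 * a.numQueries (clusterMetric L hL f) / D) := by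
  have hD' : (0 : ℝ) < D := by exact_mod_cast hD
  have hright : ∀ f : Fin n → Λ, ((g (a.run (clusterMetric L hL f))).card : ℝ) +
      2 * a.numQueries (clusterMetric L hL f) / D = ∑ c,
        ((if c ∈ g (a.run (clusterMetric L hL f)) then (1 : ℝ) else 0) +
          a.queryDegree (clusterMetric L hL f) c / D) := by
    intro f
    rw [Finset.sum_add_distrib, ← Finset.sum_div]
    have := a.sum_queryDegree (clusterMetric L hL f)
    congr 1
    · simp
    · congr 1
      exact_mod_cast this.symm
  simp only [hright, labelExpectation_sum, Finset.mul_sum]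
  refine Finset.sum_le_sum fun c _ => ?_
  -- Resampling on both sides reduces the claim to an average over the label of `c`, with all other
  -- labels fixed.
  rw [← labelExpectation_resample hw c, ← labelExpectation_const_mul]
  rw [← labelExpectation_resample hw c (fun f => S.card * σ / (1 - θ) * _)]
  refine labelExpectation_mono hw0 fun f => ?_
  simp only [Function.update_self]
  obtain ⟨B, hB, h⟩ := a.exists_blocked_labels hL f c D
  set R : Λ → Finset (Fin n) := fun l => g (a.run (clusterMetric L hL (Function.update f c l)))
  set d : Λ → ℕ := fun l => a.queryDegree (clusterMetric L hL (Function.update f c l)) c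
  change ∑ l, w l * (if l ∈ S ∧ c ∈ R l then (1 : ℝ) else 0) ≤
    ∑ l, w l * (S.card * σ / (1 - θ) * ((if c ∈ R l then (1 : ℝ) else 0) + d l / D))
  have hBw : 1 - θ ≤ ∑ l ∈ Bᶜ, w l := by
    have h1 : ∑ l ∈ B, w l ≤ θ := by
      have h2 : ∑ l ∈ B, w l ≤ B.card • (θ / D) :=
        Finset.sum_le_card_nsmul _ _ _ fun l _ => by
          rw [le_div_iff₀ hD', mul_comm]; exact hθ l
      have h0 : 0 ≤ θ := by
        obtain ⟨l, -⟩ := Finset.card_pos.1 (hD.trans_le hDS)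
        exact (mul_nonneg hD'.le (hw0 l)).trans (hθ l)
      rw [nsmul_eq_mul] at h2
      have h3 : (B.card : ℝ) * (θ / D) ≤ D * (θ / D) := by gcongr
      have h4 : (D : ℝ) * (θ / D) = θ := by field_simp
      linarith
    have := Finset.sum_add_sum_compl B w
    linarith
  have hθ' : 0 < 1 - θ := by linarith
  have hnn : ∀ l, 0 ≤ w l *
      (S.card * σ / (1 - θ) * ((if c ∈ R l then (1 : ℝ) else 0) + d l / D)) := by
    intro l
    have := hw0 l
    split_ifs <;> positivity
  have hlower : ∀ t : ℝ, 0 ≤ t →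
      (∀ l ∉ B, t ≤ (if c ∈ R l then (1 : ℝ) else 0) + d l / D) →
      S.card * σ * t ≤
        ∑ l, w l * (S.card * σ / (1 - θ) * ((if c ∈ R l then (1 : ℝ) else 0) + d l / D)) := by
    intro t ht0 ht
    calc S.card * σ * t = (1 - θ) * (S.card * σ / (1 - θ) * t) := by field_simp
      _ ≤ (∑ l ∈ Bᶜ, w l) * (S.card * σ / (1 - θ) * t) := by gcongr
      _ = ∑ l ∈ Bᶜ, w l * (S.card * σ / (1 - θ) * t) := Finset.sum_mul _ _ _
      _ ≤ ∑ l ∈ Bᶜ, w l *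
          (S.card * σ / (1 - θ) * ((if c ∈ R l then (1 : ℝ) else 0) + d l / D)) := by
        refine Finset.sum_le_sum fun l hl => ?_
        have := hw0 l
        have := ht l (Finset.mem_compl.1 hl)
        gcongr
      _ ≤ _ := Finset.sum_le_sum_of_subset_of_nonneg (Finset.subset_univ _) fun l _ _ => hnn l
  have hSsum : ∑ l ∈ S, w l = S.card * σ := by
    rw [Finset.sum_congr rfl hS, Finset.sum_const, nsmul_eq_mul]
  rcases h with ⟨C, h⟩ | h
  · refine le_trans ?_ (hlower ((if c ∈ g C then 1 else 0) + B.card / D)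
      (by split_ifs <;> positivity) fun l hl => ?_)
    -- Off `B` the output is constant, so `c` is only a guess. A label in `B ∩ S` may have been
    -- discovered, which gains at most `σ` each; the `B.card` queries pay for this since `D ≤
    -- S.card`.
    · have h1 : ∀ l, w l * (if l ∈ S ∧ c ∈ R l then (1 : ℝ) else 0) ≤
          (if l ∈ S then w l * (if c ∈ g C then 1 else 0) else 0) + if l ∈ B then σ else 0 := by
        intro l
        by_cases hl : l ∈ S
        · by_cases hlB : l ∈ B
          · have := hw0 l
            have := hS l hl
            simp only [hl, hlB, true_and, if_true]
            split_ifs <;> linarith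
          · have hRl : R l = g C := congrArg g (h l hlB).1
            simp [hl, hlB, hRl]
        · simp only [hl, false_and, if_false, mul_zero, zero_add]
          split_ifs <;> linarith
      refine (Finset.sum_le_sum fun l _ => h1 l).trans ?_
      rw [Finset.sum_add_distrib, ← Finset.sum_filter, ← Finset.sum_filter]
      simp only [Finset.filter_mem_eq_inter, Finset.univ_inter, Finset.sum_const, nsmul_eq_mul,
        ← Finset.sum_mul, hSsum, mul_add]
      have h2 : (B.card : ℝ) * σ ≤ S.card * σ * (B.card / D) := by
        have h3 : (1 : ℝ) ≤ S.card / D := by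
          rw [one_le_div hD']; exact_mod_cast hDS
        calc (B.card : ℝ) * σ = B.card * σ * 1 := by ring
          _ ≤ B.card * σ * (S.card / D) := by gcongr
          _ = _ := by ring
      linarith
    · have hRl : R l = g C := congrArg g (h l hl).1
      have hdl : (B.card : ℝ) ≤ d l := by exact_mod_cast (h l hl).2
      rw [hRl]
      gcongr
  -- Here the queries at `c` alone pay for the full mass `S.card * σ`.
  · refine le_trans ?_ (hlower 1 zero_le_one fun l hl => ?_)
    · rw [mul_one, ← hSsum, ← Finset.univ_inter S, ← Finset.filter_mem_eq_inter,
        Finset.sum_filter]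
      refine Finset.sum_le_sum fun l _ => ?_
      have := hw0 l
      by_cases hl : l ∈ S <;> by_cases hc : c ∈ R l <;> simp [hl, hc, this]
    · have hdl : (D : ℝ) ≤ d l := by exact_mod_cast h l hl
      have : (1 : ℝ) ≤ d l / D := (one_le_div hD').2 hdl
      split_ifs <;> linarith

end RandomLabels

/-! ### Hard instances for fixed parameters -/

section HardInstance

variable {n : ℕ}

open scoped Classical in
/-- The probability that an algorithm with few queries outputs `k` centers that leave at most `b`
points uncovered is small, if the clusters in `S` contain much more than `b` points. -/
theorem labelExpectation_success_le {Λ : Type*} [Fintype Λ] {w : Λ → ℝ} {L : ℝ} (hL : 1 ≤ L)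
    (hw0 : ∀ l, 0 ≤ w l) (hw : ∑ l, w l = 1) (S : Finset Λ) {σ θ : ℝ} (hS : ∀ l ∈ S, w l = σ)
    (hσ : 0 < σ) {D : ℕ} (hD : 0 < D) (hDS : D ≤ S.card) (hθ : ∀ l, D * w l ≤ θ) (hθ1 : θ < 1)
    (hn : 0 < n) {a : QueryAlgorithm n} {k T : ℕ} (hT : ∀ M, a.numQueries M ≤ T) {b : ℝ}
    (hb : b ≤ 0.44 * (S.card * (n * σ))) :
    labelExpectation w (fun f : Fin n → Λ =>
      if (a.run (clusterMetric L hL f)).card = k ∧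
        ((uncovered f (a.run (clusterMetric L hL f))).card : ℝ) ≤ b then 1 else 0) ≤
      2 * σ / (1 - θ) * (k + 2 * T / D) + 250 / (n * σ) := by
  have hn' : (0 : ℝ) < n := by exact_mod_cast hn
  have hS0 : (0 : ℝ) < S.card := by exact_mod_cast hD.trans_le hDS
  have hθ' : 0 < 1 - θ := by linarith
  set μ := n * σ with hμ
  have hμ0 : 0 < μ := by positivity
  -- Outputs of the wrong size are never successful; discarding them bounds the number of centers by
  -- `k` always.
  set g : Finset (Fin n) → Finset (Fin n) := fun C => if C.card = k then C else ∅ with hg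
  set N : (Fin n → Λ) → ℝ := fun f => ∑ c,
    if f c ∈ S ∧ c ∈ g (a.run (clusterMetric L hL f)) then (1 : ℝ) else 0 with hN
  set V : (Fin n → Λ) → ℝ := fun f => ∑ l ∈ S, (labelCount f l - μ) ^ 2 with hV
  have hEN : labelExpectation w N ≤ S.card * σ / (1 - θ) * (k + 2 * T / D) := by
    refine (labelExpectation_card_inter_le hL hw0 hw S hS hσ.le hD hDS hθ hθ1 a g).trans ?_
    gcongr
    refine (labelExpectation_mono hw0 fun f => ?_).trans_eq (labelExpectation_const hw _)
    have h1 : (g (a.run (clusterMetric L hL f))).card ≤ k := by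
      rw [hg]
      dsimp only
      split_ifs with h
      · exact h.le
      · simp
    have h1' : ((g (a.run (clusterMetric L hL f))).card : ℝ) ≤ k := by exact_mod_cast h1
    have h2 : (a.numQueries (clusterMetric L hL f) : ℝ) ≤ T := by exact_mod_cast hT _
    gcongr
  have hEV : labelExpectation w V ≤ S.card * μ := by
    rw [hV, labelExpectation_sum, ← nsmul_eq_mul]
    refine Finset.sum_le_card_nsmul _ _ _ fun l hl => ?_
    have := labelExpectation_sq_labelCount_sub_le (n := n) hw0 hw l
    rwa [hS l hl] at this
  have hN0 : ∀ f, 0 ≤ N f := fun f => Finset.sum_nonneg fun c _ => by split_ifs <;> norm_num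
  have hV0 : ∀ f, 0 ≤ V f := fun f => Finset.sum_nonneg fun c _ => sq_nonneg _
  -- Success forces `N` or `V` above its threshold, so Markov's inequality for both applies.
  calc _ ≤ labelExpectation w (fun f => 2 / S.card * N f + 250 / (S.card * μ ^ 2) * V f) := by
        refine labelExpectation_mono hw0 fun f => ?_
        have hNf := hN0 f
        have hVf := hV0 f
        split_ifs with h
        · by_cases h1 : N f < S.card / 2
          · by_cases h2 : V f < S.card * μ ^ 2 / 250
            · have hgr : g (a.run (clusterMetric L hL f)) = a.run (clusterMetric L hL f) :=
                if_pos h.1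
              have h3 := lt_card_uncovered f _ S hμ0 h1 h2
              rw [hgr] at h3
              linarith [h.2]
            · have : 1 ≤ 250 / (S.card * μ ^ 2) * V f := by
                calc 1 = 250 / (S.card * μ ^ 2) * (S.card * μ ^ 2 / 250) := by field_simp
                  _ ≤ _ := by gcongr; exact not_lt.1 h2
              have : 0 ≤ 2 / S.card * N f := by positivity
              linarith
          · have : 1 ≤ 2 / S.card * N f := by
              calc 1 = 2 / S.card * ((S.card : ℝ) / 2) := by field_simp
                _ ≤ _ := by gcongr; exact not_lt.1 h1
            have : 0 ≤ 250 / (S.card * μ ^ 2) * V f := by positivity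
            linarith
        · positivity
    _ = 2 / S.card * labelExpectation w N + 250 / (S.card * μ ^ 2) * labelExpectation w V := by
        rw [labelExpectation_add, labelExpectation_const_mul, labelExpectation_const_mul]
    _ ≤ 2 / S.card * (S.card * σ / (1 - θ) * (k + 2 * T / D)) +
          250 / (S.card * μ ^ 2) * (S.card * μ) := by gcongr
    _ = _ := by field_simp

/-- Some labelling is hard for a randomized algorithm if a random labelling is hard for each
deterministic algorithm that it chooses from. -/
theorem RandomizedAlgorithm.exists_measure_lt_half {Λ : Type*} [Fintype Λ] {w : Λ → ℝ}
    (hw0 : ∀ l, 0 ≤ w l) (hw : ∑ l, w l = 1) (A : RandomizedAlgorithm.{u} n)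
    (M : (Fin n → Λ) → MetricSpace (Fin n)) (P : (Fin n → Λ) → Finset (Fin n) → Prop)
    [∀ f, DecidablePred (P f)] {ρ : ℝ} (hρ : ρ < 1 / 2)
    (h : ∀ ω, labelExpectation w (fun f => if P f ((A.alg ω).run (M f)) then 1 else 0) ≤ ρ) :
    ∃ f, A.μ {ω | P f ((A.alg ω).run (M f))} < 1 / 2 := by
  by_contra! hcon
  have hmeas : ∀ f, MeasurableSet {ω | P f ((A.alg ω).run (M f))} := by
    intro f
    have : {ω | P f ((A.alg ω).run (M f))} =
        ⋃ C ∈ {C | P f C}, {ω | (A.alg ω).run (M f) = C} := by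
      ext ω
      simp
    rw [this]
    exact MeasurableSet.biUnion (Set.to_countable _) fun C _ => A.measurableSet_run (M f) C
  have hreal : ∀ f, 1 / 2 ≤ A.μ.real {ω | P f ((A.alg ω).run (M f))} := by
    intro f
    have := ENNReal.toReal_mono (measure_ne_top _ _) (hcon f)
    simpa [Measure.real] using this
  have hint : ∀ f, Integrable
      (fun ω => if P f ((A.alg ω).run (M f)) then (1 : ℝ) else 0) A.μ := fun f =>
    ((integrable_const (1 : ℝ)).indicator (hmeas f)).congr
      (Eventually.of_forall fun ω => by simp [Set.indicator_apply])
  have h1 : (1 : ℝ) / 2 ≤ labelExpectation w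
      (fun f => A.μ.real {ω | P f ((A.alg ω).run (M f))}) :=
    (labelExpectation_const hw _).symm.trans_le (labelExpectation_mono hw0 hreal)
  have h2 : labelExpectation w (fun f => A.μ.real {ω | P f ((A.alg ω).run (M f))}) =
      ∫ ω, labelExpectation w (fun f => if P f ((A.alg ω).run (M f)) then 1 else 0) ∂A.μ := by
    simp only [labelExpectation]
    rw [integral_finsetSum _ fun f _ => (hint f).const_mul _]
    refine Finset.sum_congr rfl fun f _ => ?_
    rw [integral_const_mul]
    congr 1
    rw [← integral_indicator_one (hmeas f)]
    simp [Set.indicator_apply]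
  have h3 : ∫ ω, labelExpectation w (fun f => if P f ((A.alg ω).run (M f)) then 1 else 0) ∂A.μ ≤
      ∫ _, ρ ∂A.μ := by
    refine integral_mono ?_ (integrable_const _) h
    simp only [labelExpectation]
    exact integrable_finsetSum _ fun f _ => (hint f).const_mul _
  simp at h3
  linarith

/-- On the instance `M`, the algorithm is unlikely to output an `(α, β)`-approximation for any
`α, β ≤ H`. -/
def RandomizedAlgorithm.IsHardInstance (A : RandomizedAlgorithm.{u} n) (obj : Objective)
    (k z H : ℕ) (M : MetricSpace (Fin n)) : Prop :=
  ∀ α β : ℝ≥0, α ≤ H → β ≤ H → 20 * β * (z : ℝ≥0) ≤ (n : ℝ≥0) →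
    A.successProb obj M k z α β < 1 / 2

/-- A choice of the total probability `p` of the small clusters. -/
theorem exists_smallMass {n z H : ℝ} (hz : 0 < z) (hn : 10000 * z ≤ n) (hH : 0 ≤ H) :
    ∃ p, 0 < p ∧ p ≤ 1 / 8 ∧ p * n ≤ 3 * (H + 1) * z ∧ 3 * z ≤ p * n ∧
      min (H * z) (n / 20) ≤ 0.44 * (p * n) := by
  have hn0 : 0 < n := by linarith
  have hHz : 0 ≤ H * z := by positivity
  have hpn : min (1 / 8) (3 * (H + 1) * z / n) * n = min (n / 8) (3 * (H + 1) * z) := by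
    rw [min_mul_of_nonneg _ _ hn0.le]
    congr 1
    · ring
    · field_simp
  -- The cap `1 / 8` suffices for `n / 20` since `0.44 / 8 > 1 / 20`; otherwise `0.44 * 3 > 1`
  -- handles `H * z`.
  refine ⟨min (1 / 8) (3 * (H + 1) * z / n), ?_, min_le_left _ _, ?_, ?_, ?_⟩
  · exact lt_min (by norm_num) (by positivity)
  · rw [hpn]
    exact min_le_right _ _
  · rw [hpn]
    exact le_min (by linarith) (by linarith)
  · rw [hpn]
    rcases min_choice (n / 8) (3 * (H + 1) * z) with h | h
    · rw [h]
      linarith [min_le_right (H * z) (n / 20)]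
    · rw [h]
      linarith [min_le_left (H * z) (n / 20)]

/-- The success probability for clusters of total probability `p` and few queries. -/
theorem smallMass_bound {p n z H k D T : ℝ} (hp0 : 0 < p) (hp8 : p ≤ 1 / 8) (hz0 : 0 < z)
    (hn0 : 0 < n) (hH : 0 ≤ H) (hpz : p * n ≤ 3 * (H + 1) * z) (hpn3 : 3 * z ≤ p * n)
    (hD0 : 0 < D) (hkR : k ≤ 41 * D) (hkR' : 40 * D ≤ k) (hzR : 10000 * k ≤ z)
    (hT : T ≤ 1 / (100000 * (H + 1)) * (n * k ^ 2 / z)) :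
    2 * (p / (30 * D)) / (1 - 1 / 10) * (k + 2 * T / D) + 250 / (n * (p / (30 * D))) ≤ 0.45 := by
  have hk0 : 0 ≤ k := by linarith
  have hpT : p * T ≤ 0.06 * D ^ 2 := by
    calc p * T ≤ p * (1 / (100000 * (H + 1)) * (n * k ^ 2 / z)) := by gcongr
      _ = p * n * (k ^ 2 / (100000 * (H + 1) * z)) := by field_simp
      _ ≤ 3 * (H + 1) * z * ((41 * D) ^ 2 / (100000 * (H + 1) * z)) := by gcongr
      _ = 3 * 1681 / 100000 * D ^ 2 := by field_simp; ring
      _ ≤ 0.06 * D ^ 2 := by gcongr; norm_num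
  have h1 : 2 * (p / (30 * D)) / (1 - 1 / 10) * (k + 2 * T / D) =
      2 / 27 * (p * k / D) + 4 / 27 * (p * T / D ^ 2) := by
    field_simp
    ring
  have h2 : p * k / D ≤ 41 / 8 := by
    rw [div_le_iff₀ (by linarith)]
    calc p * k ≤ 1 / 8 * (41 * D) := by gcongr
      _ = _ := by ring
  have h3 : p * T / D ^ 2 ≤ 0.06 := by
    rwa [div_le_iff₀ (by positivity)]
  have h4 : 250 / (n * (p / (30 * D))) ≤ (0.01 : ℝ) := by
    rw [div_le_iff₀ (by positivity)]
    have : n * (p / (30 * D)) = p * n / (30 * D) := by ring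
    rw [this]
    -- The mean size of a small cluster is large: `3 * z ≥ 30000 * k ≥ 40000 * (30 * D)`.
    have : 40000 ≤ p * n / (30 * D) := by
      rw [le_div_iff₀ (by positivity)]
      linarith
    linarith
  rw [h1]
  linarith

/-- An algorithm with few queries has a hard instance: `30 * D` small and `10 * D` large clusters,
where `D = k / 40`, with random labels. -/
theorem RandomizedAlgorithm.exists_isHardInstance (A : RandomizedAlgorithm.{u} n)
    (obj : Objective) {k z H T : ℕ} (hA : A.MakesAtMost T) (hk : 1600 ≤ k)
    (hz : 10000 * k ≤ z) (hn : 10000 * z ≤ n) (hH : H < n)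
    (hT : (T : ℝ) ≤ 1 / (100000 * (H + 1)) * (n * k ^ 2 / z)) :
    ∃ M, A.IsHardInstance obj k z H M := by
  classical
  set D := k / 40 with hD
  have hD40 : 40 ≤ D := by omega
  have hkD : 40 * D ≤ k := by omega
  have hkD' : k ≤ 41 * D := by omega
  have hD0 : (40 : ℝ) ≤ D := by exact_mod_cast hD40
  have hkR : (k : ℝ) ≤ 41 * D := by exact_mod_cast hkD'
  have hkR' : 40 * (D : ℝ) ≤ k := by exact_mod_cast hkD
  have hzR : 10000 * (k : ℝ) ≤ z := by exact_mod_cast hz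
  have hnR : 10000 * (z : ℝ) ≤ n := by exact_mod_cast hn
  have hz0 : (0 : ℝ) < z := by linarith
  have hn0 : (0 : ℝ) < n := by linarith
  have hnpos : 0 < n := by exact_mod_cast hn0
  obtain ⟨p, hp0, hp8, hpz, hpn3, hpb⟩ := exists_smallMass hz0 hnR (Nat.cast_nonneg' H)
  set w : Fin (30 * D) ⊕ Fin (10 * D) → ℝ :=
    Sum.elim (fun _ => p / (30 * D)) (fun _ => (1 - p) / (10 * D)) with hwdef
  have hw0 : ∀ l, 0 ≤ w l := by
    rintro (l | l)
    · exact div_nonneg hp0.le (by linarith)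
    · exact div_nonneg (by linarith) (by linarith)
  have hw : ∑ l, w l = 1 := by
    simp [hwdef]
    field_simp
    ring
  set S : Finset (Fin (30 * D) ⊕ Fin (10 * D)) := Finset.univ.map Function.Embedding.inl with hSdef
  have hScard : S.card = 30 * D := by simp [hSdef]
  have hS : ∀ l ∈ S, w l = p / (30 * D) := by
    intro l hl
    simp only [hSdef, Finset.mem_map, Finset.mem_univ, true_and] at hl
    obtain ⟨l, rfl⟩ := hl
    rfl
  -- The large mass is spread over `10 * D` clusters so that `D` excluded labels of any kind weigh
  -- at most `1 / 10`.
  have hθ : ∀ l, D * w l ≤ 1 / 10 := by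
    rintro (l | l)
    · change D * (p / (30 * D)) ≤ 1 / 10
      field_simp
      linarith
    · change D * ((1 - p) / (10 * D)) ≤ 1 / 10
      field_simp
      linarith
  have hL : (1 : ℝ) ≤ (n : ℝ) ^ 2 := one_le_pow₀ (by exact_mod_cast hnpos)
  -- Both bounds on `β * z` are kept, because `H * z` may exceed `n`.
  set b : ℝ := min (H * z) (n / 20) with hb
  have hbS : b ≤ 0.44 * (S.card * (n * (p / (30 * D)))) := by
    have h1 : (S.card : ℝ) * (n * (p / (30 * D))) = p * n := by
      rw [hScard]
      push_cast
      field_simp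
    rwa [h1]
  have hρ := smallMass_bound hp0 hp8 hz0 hn0 (Nat.cast_nonneg' H) hpz hpn3 (by linarith) hkR hkR'
    hzR hT
  have hbound := fun ω => (labelExpectation_success_le hL hw0 hw S hS
    (div_pos hp0 (by linarith)) (by omega) (by omega) hθ (by norm_num) hnpos
    (fun M => hA M ω) hbS).trans hρ
  obtain ⟨f, hf⟩ := A.exists_measure_lt_half hw0 hw (fun f => clusterMetric _ hL f)
    (fun f C => C.card = k ∧ ((uncovered f C).card : ℝ) ≤ b) (by norm_num) hbound
  refine ⟨clusterMetric _ hL f, fun α β hα hβ hβz => (measure_mono fun ω hω => ?_).trans_lt hf⟩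
  refine ⟨hω.1, (hω.card_uncovered_le ?_ (by omega) (by omega) hnpos ?_).trans
    (le_min ?_ ?_)⟩
  · simp
    omega
  · have h1 : (α : ℝ) ≤ H := by exact_mod_cast hα
    have h2 : (H : ℝ) < n := by exact_mod_cast hH
    rw [sq]
    gcongr
    linarith
  · have h1 : (β : ℝ) ≤ H := by exact_mod_cast hβ
    gcongr
  · have h1 : 20 * (β : ℝ) * z ≤ n := by exact_mod_cast hβz
    linarith

end HardInstance

/-! ### Asymptotics and a single instance for all `α` and `β` -/

theorem tendsto_parameterFilter :
    Tendsto (fun p : ℕ × ℕ × ℕ => p.1) parameterFilter atTop ∧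
      Tendsto (fun p : ℕ × ℕ × ℕ => p.2.2) parameterFilter atTop :=
  ⟨tendsto_fst.mono_left inf_le_left,
    (tendsto_snd.comp tendsto_snd).mono_left inf_le_left⟩

/-- Since `log k ≥ 1` eventually, the constraint yields `10000 * k ≤ z`; the little-o hypothesis is
applied with the constant `1 / (100000 * (H + 1))`. -/
theorem eventually_exists_isHardInstance (obj : Objective)
    (A : (k z n : ℕ) → RandomizedAlgorithm.{u} n) (T : ℕ → ℕ → ℕ → ℕ)
    (hA : ∀ k z n : ℕ, (A k z n).MakesAtMost (T k z n))
    (hT : (fun p : ℕ × ℕ × ℕ => (T p.1 p.2.1 p.2.2 : ℝ)) =o[parameterFilter]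
      fun p => (p.2.2 : ℝ) * (p.1 : ℝ) ^ 2 / (p.2.1 : ℝ)) (H : ℕ) :
    ∀ᶠ p in parameterFilter,
      ∃ M, (A p.1 p.2.1 p.2.2).IsHardInstance obj p.1 p.2.1 H M := by
  have hconstr : ∀ᶠ p : ℕ × ℕ × ℕ in parameterFilter,
      10000 * (p.1 : ℝ) * Real.log p.1 ≤ p.2.1 ∧ (p.2.1 : ℝ) ≤ p.2.2 / 10000 :=
    Eventually.filter_mono inf_le_right (mem_principal_self _)
  filter_upwards [hconstr, tendsto_parameterFilter.1.eventually_ge_atTop 1600,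
    tendsto_parameterFilter.2.eventually_gt_atTop H,
    hT.bound (show (0 : ℝ) < 1 / (100000 * (H + 1)) by positivity)] with p hp hk hH hTp
  refine (A p.1 p.2.1 p.2.2).exists_isHardInstance obj (hA _ _ _) hk ?_ ?_ hH ?_
  · have hk' : (1600 : ℝ) ≤ p.1 := by exact_mod_cast hk
    have hlog : 1 ≤ Real.log p.1 := by
      rw [Real.le_log_iff_exp_le (by linarith)]
      linarith [Real.exp_one_lt_d9]
    have : 10000 * (p.1 : ℝ) * 1 ≤ 10000 * (p.1 : ℝ) * Real.log p.1 := by gcongr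
    have : 10000 * (p.1 : ℝ) ≤ p.2.1 := by linarith [hp.1]
    exact_mod_cast this
  · have : 10000 * (p.2.1 : ℝ) ≤ p.2.2 := by linarith [hp.2]
    exact_mod_cast this
  · rwa [Real.norm_of_nonneg (by positivity), Real.norm_of_nonneg (by positivity)] at hTp

theorem mainTheorem3 (obj : Objective)
    (A : (k z n : ℕ) → RandomizedAlgorithm.{u} n) (T : ℕ → ℕ → ℕ → ℕ)
    (hA : ∀ k z n : ℕ, (A k z n).MakesAtMost (T k z n))
    (hT : (fun p : ℕ × ℕ × ℕ => (T p.1 p.2.1 p.2.2 : ℝ)) =o[parameterFilter]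
      fun p => (p.2.2 : ℝ) * (p.1 : ℝ) ^ 2 / (p.2.1 : ℝ)) :
    ∃ I : (k z n : ℕ) → MetricSpace (Fin n), ∀ α β : ℝ≥0,
      ∀ᶠ p in parameterFilter, 20 * β * (p.2.1 : ℝ≥0) ≤ (p.2.2 : ℝ≥0) →
        (A p.1 p.2.1 p.2.2).successProb obj (I p.1 p.2.1 p.2.2) p.1 p.2.1 α β < 1 / 2 := by
  classical
  -- Choose an instance that is hard for the largest possible bound `H ≤ k` on `α` and `β`.
  have hI : ∀ k z n : ℕ, ∃ M : MetricSpace (Fin n), ∀ H ≤ k,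
      (∃ M', (A k z n).IsHardInstance obj k z H M') → (A k z n).IsHardInstance obj k z H M := by
    intro k z n
    set Q : ℕ → Prop := fun H => ∃ M, (A k z n).IsHardInstance obj k z H M
    by_cases hQ : ∃ H ≤ k, Q H
    · obtain ⟨H₀, hH₀k, hH₀⟩ := hQ
      obtain ⟨M, hM⟩ : Q (Nat.findGreatest Q k) := Nat.findGreatest_spec hH₀k hH₀
      -- Hardness for a bound implies hardness for every smaller one. The cap `k` makes a largest
      -- bound exist, and it eventually exceeds any fixed `H`.
      refine ⟨M, fun H hH hQH α β hα hβ => hM α β ?_ ?_⟩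
      all_goals
        have : H ≤ Nat.findGreatest Q k := Nat.le_findGreatest hH hQH
        have : (H : ℝ≥0) ≤ (Nat.findGreatest Q k : ℕ) := by exact_mod_cast this
      · exact hα.trans this
      · exact hβ.trans this
    · push Not at hQ
      exact ⟨clusterMetric 1 le_rfl id, fun H hH hQH => absurd hQH (hQ H hH)⟩
  choose I hI using hI
  refine ⟨I, fun α β => ?_⟩
  obtain ⟨H, hH⟩ := exists_nat_ge (max α β)
  filter_upwards [eventually_exists_isHardInstance obj A T hA hT H,
    tendsto_parameterFilter.1.eventually_ge_atTop H] with p hp hk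
  exact hI _ _ _ H hk hp α β ((le_max_left _ _).trans hH) ((le_max_right _ _).trans hH)
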